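/- **Setting.** Let $p,m,d\ge 1$ and let $G_1,\dots,G_m\subseteq\{1,\dots,p\}$ be pairwise disjoint groups with $\bigcup_j G_j=\{1,\dots,p\}$ and $|G_j|=d$ for every $j$. Let $s,s_0$ be integers with $1\le s\le m$ and $1\le s_0\le d$, and put $$\mathcal{DS}(s,s_0)=\Big\{\beta\in\mathbb R^p:\ \#\{j:\beta_{G_j}\ne 0\}\le s,\ \#\{i:\beta_i\neq 0\}\le s s_0\Big\}.$$ A matrix $X\in\mathbb R^{n\times p}$ satisfies $DSRE(s,s_0,\theta)$ if $$\theta=\min_{\beta\in\mathcal{DS}(s,s_0)\setminus\{0\}}\frac{\|X\beta\|_2}{\|\beta\|_2}\quad\text{and}\quad\theta>0 .$$ A random vector $x$ in $\mathbb R^p$ satisfies the small ball condition over $\mathcal{DS}(s,s_0)$ with constants $\tau,\theta_{\min}>0$ if $$\mathbf P\big(|\langle\beta,x\rangle|\ge\theta_{\min}\|\beta\|_2\big)\ge\tau\qquad\text{for all }\beta\in\mathcal{DS}(s,s_0).$$ **Theorem.** There are absolute constants $C,C'>0$ such that, for all $p,m,d,n,s,s_0,G_1,\dots,G_m$ as above,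 all $\tau,\theta_{\min}>0$, and every random vector $x$ satisfying the small ball condition over $\mathcal{DS}(s,s_0)$ with constants $\tau,\theta_{\min}$, the following holds. Let $X\in\mathbb R^{n\times p}$ be a random matrix whose rows are independent and have the same distribution as $x$, and suppose that $$n\ \ge\ \frac{C}{\tau^2}\Big(s\log\frac{em}{s}+s s_0\log\frac{ed}{s_0}\Big).$$ Then, with probability greater than $1-\exp(-C'n\tau^2)$, both of the following hold: 1. $X$ satisfies $DSRE(s,s_0,\theta)$ for some $\theta\ge\theta_{\min}/\sqrt2$; 2. the normalized matrix $\frac1{\sqrt n}X$ satisfies $DSRE(s,s_0,\theta')$ for some $\theta'\ge\sqrt{\tau/2}\,\theta_{\min}$. -/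

import Mathlib

open MeasureTheory ProbabilityTheory

/-- `G 0, …, G (m-1)` are non-overlapping groups of `d` variables each, which together make up all
the `p` variables. -/
structure IsGrouping {p m : ℕ} (d : ℕ) (G : Fin m → Finset (Fin p)) : Prop where
  disjoint : ∀ j k : Fin m, j ≠ k → Disjoint (G j) (G k)
  cover : ∀ i : Fin p, ∃ j : Fin m, i ∈ G j
  card_eq : ∀ j : Fin m, (G j).card = d

/-- `‖β‖₀`, the number of nonzero coordinates. -/
noncomputable def zeroNorm {p : ℕ} (β : EuclideanSpace ℝ (Fin p)) : ℕ :=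
  {i : Fin p | β i ≠ 0}.ncard

/-- `‖β‖_{0,2}`, the number of groups on which `β` does not vanish identically. -/
noncomputable def groupZeroNorm {p m : ℕ} (G : Fin m → Finset (Fin p))
    (β : EuclideanSpace ℝ (Fin p)) : ℕ :=
  {j : Fin m | ∃ i ∈ G j, β i ≠ 0}.ncard

/-- The double sparse parameter space `DS(s, s₀)`. -/
def doubleSparse {p m : ℕ} (G : Fin m → Finset (Fin p)) (s s₀ : ℕ) :
    Set (EuclideanSpace ℝ (Fin p)) :=
  {β | groupZeroNorm G β ≤ s ∧ zeroNorm β ≤ s * s₀}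

/-- The Euclidean norm `‖Xβ‖₂` of the image of `β` under the matrix `X`. -/
noncomputable def imageNorm {n p : ℕ} (X : Matrix (Fin n) (Fin p) ℝ)
    (β : EuclideanSpace ℝ (Fin p)) : ℝ :=
  ‖(WithLp.toLp 2 (X.mulVec β.ofLp) : EuclideanSpace ℝ (Fin n))‖

/-- The double sparse restricted eigenvalue condition `DSRE(s, s₀, θ)`: `θ` is positive and is the
minimum of `‖Xβ‖₂ / ‖β‖₂` over the nonzero `β` in `DS(s, s₀)`. -/
def DSRE {n p m : ℕ} (G : Fin m → Finset (Fin p)) (s s₀ : ℕ) (θ : ℝ)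
    (X : Matrix (Fin n) (Fin p) ℝ) : Prop :=
  0 < θ ∧
    IsLeast {r : ℝ | ∃ β ∈ doubleSparse G s s₀, β ≠ 0 ∧ r = imageNorm X β / ‖β‖} θ

/-- The small ball condition over `DS(s, s₀)`, with constants `τ` and `θmin`, for a random vector
`x` under the probability measure `μ`. -/
def SmallBall {Ω : Type*} [MeasurableSpace Ω] {p m : ℕ} (μ : Measure Ω)
    (x : Ω → EuclideanSpace ℝ (Fin p)) (G : Fin m → Finset (Fin p)) (s s₀ : ℕ)
    (τ θmin : ℝ) : Prop :=
  ∀ β ∈ doubleSparse G s s₀, τ ≤ μ.real {ω | θmin * ‖β‖ ≤ |inner ℝ β (x ω)|}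

/-- The matrix with rows `v 0, …, v (n-1)`. -/
def matrixOfRows {n p : ℕ} (v : Fin n → EuclideanSpace ℝ (Fin p)) :
    Matrix (Fin n) (Fin p) ℝ :=
  Matrix.of fun i j => v i j

/-! If every `β` in the parameter space has at least `nτ/2` rows with `|⟨β, row⟩| ≥ θmin‖β‖`, then
`‖Xβ‖² ≥ (nτ/2) θmin² ‖β‖²`; this gives the second bound after scaling and, since `nτ ≥ 1`, the
first. Compactness of the unit sphere of the parameter space turns lower bounds into minima.

The uniform count is a one-sided Vapnik–Chervonenkis bound,
`measureReal_exists_card_sampleTrace_lt_le`. Hits in the sample are weighted by `3/4`, hits in a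
ghost sample by `5/4`. Exchangeability bounds the mean of the supremum of the weights by the number
`S` of traces, whereas a deficient sample forces a mean weight of at least `exp(nτ/20)`.

By `exists_traces_slabCompl`, `S` is at most the number of supports times a Sauer–Shelah bound for
half-spaces. `card_bound_mul_exp_lt` checks that the assumed `n` beats it. -/

open scoped ENNReal

/-! ### Symmetrization with a ghost sample -/

section GhostSample

open Classical in
/-- The weight of a pair `(e, e')` with respect to a set: `3/4` if the first member of the pair is
in the set, times `5/4` if the second one is. -/
noncomputable def pairWeight (a a' : Prop) : ℝ≥0∞ :=
  (if a then ENNReal.ofReal (3 / 4) else 1) * (if a' then ENNReal.ofReal (5 / 4) else 1)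

/-- Since `3/4 + 5/4 = 2` and `3/4 · 5/4 < 1`, a fair random swap gives each pair mean weight at
most `1`. -/
lemma pairWeight_add_swap_le (a a' : Prop) : pairWeight a a' + pairWeight a' a ≤ 2 := by
  have h2 : (2 : ℝ≥0∞) = ENNReal.ofReal 2 := by simp
  unfold pairWeight
  by_cases h : a <;> by_cases h' : a' <;> simp only [h, h', if_true, if_false, one_mul, mul_one]
  · rw [← ENNReal.ofReal_mul (by norm_num), ← ENNReal.ofReal_add (by norm_num) (by norm_num), h2]
    exact ENNReal.ofReal_le_ofReal (by norm_num)
  · rw [← ENNReal.ofReal_add (by norm_num) (by norm_num), h2]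
    exact ENNReal.ofReal_le_ofReal (by norm_num)
  · rw [← ENNReal.ofReal_add (by norm_num) (by norm_num), h2]
    exact ENNReal.ofReal_le_ofReal (by norm_num)
  · norm_num

variable {E ι κ : Type*} [Fintype κ]

open Classical in
/-- The members of a finite family of points that lie in a given set. -/
noncomputable def sampleTrace {J : Type*} [Fintype J] (v : J → E) (A : Set E) : Finset J :=
  {j | v j ∈ A}

@[simp] lemma mem_sampleTrace {J : Type*} [Fintype J] {v : J → E} {A : Set E} {j : J} :
    j ∈ sampleTrace v A ↔ v j ∈ A := by simp [sampleTrace]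

/-- The product of the pair weights of a sample and its ghost sample. -/
noncomputable def sampleWeight (A : Set E) (Z : κ → E × E) : ℝ≥0∞ :=
  ∏ i, pairWeight ((Z i).1 ∈ A) ((Z i).2 ∈ A)

/-- Exchange the members of those pairs which `σ` marks. -/
def swapPairs (σ : κ → Bool) (Z : κ → E × E) : κ → E × E :=
  fun i => bif σ i then (Z i).swap else Z i

lemma sum_prod_pairWeight_le [DecidableEq κ] (u : Finset (κ × Bool)) :
    ∑ σ : κ → Bool, ∏ i, pairWeight ((i, σ i) ∈ u) ((i, !σ i) ∈ u) ≤ 2 ^ Fintype.card κ := by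
  classical
  have h := Finset.prod_univ_sum (fun _ : κ => (Finset.univ : Finset Bool))
    (fun i b => pairWeight ((i, b) ∈ u) ((i, !b) ∈ u))
  rw [Fintype.piFinset_univ] at h
  rw [← h]
  calc _ ≤ ∏ _i : κ, (2 : ℝ≥0∞) := by
        refine Finset.prod_le_prod' fun i _ => ?_
        simpa using pairWeight_add_swap_le ((i, true) ∈ u) ((i, false) ∈ u)
    _ = _ := by simp

/-- Swaps only permute the pooled points, so the trace on these determines the weight for every `σ`.
The supremum is then bounded by a sum over the at most `S` traces. -/
lemma sum_iSup_sampleWeight_swapPairs_le [DecidableEq κ] (A : ι → Set E) (S : ℕ)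
    (hS : ∀ v : κ × Bool → E, ∃ F : Finset (Finset (κ × Bool)),
      F.card ≤ S ∧ ∀ b, sampleTrace v (A b) ∈ F) (Z : κ → E × E) :
    ∑ σ : κ → Bool, ⨆ b, sampleWeight (A b) (swapPairs σ Z) ≤ S * 2 ^ Fintype.card κ := by
  obtain ⟨F, hF, hA⟩ := hS fun j => bif j.2 then (Z j.1).2 else (Z j.1).1
  calc _ ≤ ∑ σ : κ → Bool, ∑ u ∈ F, ∏ i, pairWeight ((i, σ i) ∈ u) ((i, !σ i) ∈ u) := by
        refine Finset.sum_le_sum fun σ _ => iSup_le fun b => ?_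
        refine le_trans (le_of_eq ?_) (Finset.single_le_sum
          (f := fun u => ∏ i, pairWeight ((i, σ i) ∈ u) ((i, !σ i) ∈ u)) (fun _ _ => zero_le)
          (hA b))
        refine Finset.prod_congr rfl fun i _ => ?_
        cases h : σ i <;> simp [swapPairs, h]
    _ = ∑ u ∈ F, ∑ σ : κ → Bool, ∏ i, pairWeight ((i, σ i) ∈ u) ((i, !σ i) ∈ u) :=
        Finset.sum_comm
    _ ≤ ∑ _u ∈ F, 2 ^ Fintype.card κ := Finset.sum_le_sum fun u _ => sum_prod_pairWeight_le u
    _ ≤ _ := by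
        rw [Finset.sum_const, nsmul_eq_mul]
        gcongr

open Classical in
lemma le_prod_ite (A : Set E) (y : κ → E) (t : ℝ) (ht : ((sampleTrace y A).card : ℝ) ≤ t) :
    ENNReal.ofReal (Real.exp (-(3 * t / 10))) ≤
      ∏ i, (if y i ∈ A then ENNReal.ofReal (3 / 4) else 1) := by
  rw [Finset.prod_ite, Finset.prod_const_one, mul_one, Finset.prod_const,
    ← ENNReal.ofReal_pow (by norm_num)]
  refine ENNReal.ofReal_le_ofReal ?_
  have h : Real.exp (-(3 / 10)) ≤ 3 / 4 := by
    rw [Real.exp_neg, inv_le_comm₀ (Real.exp_pos _) (by norm_num)]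
    -- `1 + 0.3 + 0.3²/2 = 1.345 ≥ 4/3`.
    refine le_trans ?_ (Real.quadratic_le_exp_of_nonneg (by norm_num))
    norm_num
  change _ ≤ (3 / 4 : ℝ) ^ (sampleTrace y A).card
  calc _ ≤ Real.exp (((sampleTrace y A).card : ℝ) * -(3 / 10)) := by
        rw [Real.exp_le_exp]; linarith
    _ = Real.exp (-(3 / 10)) ^ (sampleTrace y A).card := Real.exp_nat_mul _ _
    _ ≤ _ := by gcongr

variable [MeasurableSpace E]

lemma measurable_pairWeight {α : Type*} [MeasurableSpace α] {s t : Set α} (hs : MeasurableSet s)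
    (ht : MeasurableSet t) : Measurable fun a => pairWeight (a ∈ s) (a ∈ t) := by
  unfold pairWeight
  exact (Measurable.ite hs measurable_const measurable_const).mul
    (Measurable.ite ht measurable_const measurable_const)

lemma measurable_sampleWeight {A : Set E} (hA : MeasurableSet A) :
    Measurable (sampleWeight A : (κ → E × E) → ℝ≥0∞) := by
  unfold sampleWeight
  refine Finset.measurable_prod _ fun i _ => ?_
  exact (measurable_pairWeight (measurable_fst hA) (measurable_snd hA)).comp (measurable_pi_apply i)

variable (ν : Measure E) [IsProbabilityMeasure ν]

lemma measurePreserving_swapPairs (σ : κ → Bool) :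
    MeasurePreserving (swapPairs σ) (Measure.pi fun _ : κ => ν.prod ν)
      (Measure.pi fun _ : κ => ν.prod ν) := by
  refine measurePreserving_pi (f := fun i (z : E × E) => bif σ i then z.swap else z) _ _ fun i => ?_
  cases σ i
  · exact MeasurePreserving.id _
  · exact Measure.measurePreserving_swap

lemma lintegral_iSup_sampleWeight_le [DecidableEq κ] [Countable ι] (A : ι → Set E)
    (hA : ∀ b, MeasurableSet (A b)) (S : ℕ)
    (hS : ∀ v : κ × Bool → E, ∃ F : Finset (Finset (κ × Bool)),
      F.card ≤ S ∧ ∀ b, sampleTrace v (A b) ∈ F) :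
    ∫⁻ Z, ⨆ b, sampleWeight (A b) Z ∂(Measure.pi fun _ : κ => ν.prod ν) ≤ S := by
  set μ := Measure.pi fun _ : κ => ν.prod ν
  have hm : Measurable fun Z : κ → E × E => ⨆ b, sampleWeight (A b) Z :=
    Measurable.iSup fun b => measurable_sampleWeight (hA b)
  have hsum : ∑ σ : κ → Bool, ∫⁻ Z, ⨆ b, sampleWeight (A b) (swapPairs σ Z) ∂μ
      ≤ S * 2 ^ Fintype.card κ := by
    rw [← lintegral_finsetSum (f := fun σ Z => ⨆ b, sampleWeight (A b) (swapPairs σ Z)) _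
      fun σ _ => hm.comp (measurePreserving_swapPairs ν σ).measurable]
    calc _ ≤ ∫⁻ _Z : κ → E × E, (S * 2 ^ Fintype.card κ : ℝ≥0∞) ∂μ :=
          lintegral_mono fun Z => sum_iSup_sampleWeight_swapPairs_le A S hS Z
      _ = _ := by simp
  -- Swaps preserve the law, so all `2 ^ card κ` summands equal the integral to be bounded.
  rw [Finset.sum_congr rfl fun σ _ => (measurePreserving_swapPairs ν σ).lintegral_comp hm,
    Finset.sum_const, nsmul_eq_mul, mul_comm] at hsum
  have hc : ((Finset.univ : Finset (κ → Bool)).card : ℝ≥0∞) = 2 ^ Fintype.card κ := by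
    simp [Finset.card_univ]
  rw [hc] at hsum
  exact (ENNReal.mul_le_mul_iff_left (by simp) (by simp)).1 hsum

open Classical in
lemma lintegral_prod_ite_ge {A : Set E} (hA : MeasurableSet A) {τ : ℝ} (hτ₀ : 0 < τ)
    (hτ : τ ≤ ν.real A) :
    ENNReal.ofReal (Real.exp (Fintype.card κ * τ / 5)) ≤
      ∫⁻ z : κ → E, ∏ i, (if z i ∈ A then ENNReal.ofReal (5 / 4) else 1)
        ∂(Measure.pi fun _ => ν) := by
  have hτ₁ : τ ≤ 1 := hτ.trans measureReal_le_one
  have hg : Measurable fun e : E => if e ∈ A then ENNReal.ofReal (5 / 4) else 1 :=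
    Measurable.ite hA measurable_const measurable_const
  have hind := iIndepFun_pi (μ := fun _ : κ => ν)
    (X := fun _ e => if e ∈ A then ENNReal.ofReal (5 / 4) else 1) fun _ => hg.aemeasurable
  rw [lintegral_prod_eq_prod_lintegral_of_indepFun Finset.univ _ hind
    fun i => hg.comp (measurable_pi_apply i)]
  have h1 : ∫⁻ e, (if e ∈ A then ENNReal.ofReal (5 / 4) else 1) ∂ν
      = ENNReal.ofReal (1 + ν.real A / 4) := by
    have : ∀ e, (if e ∈ A then ENNReal.ofReal (5 / 4) else 1)
        = 1 + A.indicator (fun _ => ENNReal.ofReal (1 / 4)) e := by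
      intro e
      by_cases h : e ∈ A
      · simp only [h, if_true, Set.indicator_of_mem]
        rw [← ENNReal.ofReal_one, ← ENNReal.ofReal_add (by norm_num) (by norm_num)]
        norm_num
      · simp [h]
    simp_rw [this]
    rw [lintegral_add_left measurable_const, lintegral_indicator_const hA,
      ENNReal.ofReal_add (by norm_num) (by positivity), div_eq_mul_one_div (ν.real A),
      mul_comm (ν.real A), ENNReal.ofReal_mul (by norm_num), ofReal_measureReal]
    simp
  have h2 : ∀ i : κ, ∫⁻ z : κ → E, (if z i ∈ A then ENNReal.ofReal (5 / 4) else 1)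
      ∂(Measure.pi fun _ => ν) = ENNReal.ofReal (1 + ν.real A / 4) := fun i => by
    rw [← h1]
    exact (measurePreserving_eval (fun _ : κ => ν) i).lintegral_comp hg
  rw [Finset.prod_congr rfl fun i _ => h2 i, Finset.prod_const, Finset.card_univ,
    ← ENNReal.ofReal_pow (by positivity)]
  refine ENNReal.ofReal_le_ofReal ?_
  have h3 : Real.exp (τ / 5) ≤ 1 + ν.real A / 4 := by
    refine le_trans ?_ (show 1 + τ / 4 ≤ _ by linarith)
    rw [← Real.le_log_iff_exp_le (by positivity)]
    -- `log(1 + τ/4) ≥ τ/(4 + τ) ≥ τ/5`, as `τ ≤ 1`.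
    refine le_trans ?_ (Real.one_sub_inv_le_log_of_pos (by positivity))
    rw [le_sub_iff_add_le, ← le_sub_iff_add_le', inv_le_comm₀ (by positivity) (by linarith),
      inv_le_comm₀ (by linarith) (by positivity), ← one_div, div_le_iff₀ (by positivity)]
    nlinarith
  calc Real.exp (Fintype.card κ * τ / 5) = Real.exp (τ / 5) ^ Fintype.card κ := by
        rw [← Real.exp_nat_mul]; ring_nf
    _ ≤ _ := by gcongr

/-- A relative deviation inequality of Vapnik–Chervonenkis type: if all sets of a countable family
have probability at least `τ` and their traces on a double sample number at most `S`, then all of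
them are hit by at least half the expected number of points of a sample, except with a
probability which is at most `S` times an exponentially small factor. -/
theorem measureReal_exists_card_sampleTrace_lt_le [Countable ι] (A : ι → Set E)
    (hA : ∀ b, MeasurableSet (A b)) {τ : ℝ} (hτ₀ : 0 < τ) (hτ : ∀ b, τ ≤ ν.real (A b)) (S : ℕ)
    (hS : ∀ v : κ × Bool → E, ∃ F : Finset (Finset (κ × Bool)),
      F.card ≤ S ∧ ∀ b, sampleTrace v (A b) ∈ F) :
    (Measure.pi fun _ : κ => ν).real
        {y | ∃ b, ((sampleTrace y (A b)).card : ℝ) < Fintype.card κ * τ / 2}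
      ≤ S * Real.exp (-(Fintype.card κ * τ / 20)) := by
  classical
  set N : ℝ := (Fintype.card κ : ℝ) with hN
  set π := Measure.pi fun _ : κ => ν
  set U : Set (κ → E) := {y | ∃ b, ((sampleTrace y (A b)).card : ℝ) < N * τ / 2} with hU
  have hUm : MeasurableSet U := by
    rw [hU, Set.ofPred_exists]
    refine MeasurableSet.iUnion fun b => measurableSet_lt ?_ measurable_const
    simp only [sampleTrace, Finset.card_filter, Nat.cast_sum]
    refine Finset.measurable_sum _ fun i _ => ?_
    simp only [Nat.cast_ite]
    exact Measurable.ite (measurable_pi_apply i (hA b)) measurable_const measurable_const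
  have hm : Measurable fun Z : κ → E × E => ⨆ b, sampleWeight (A b) Z :=
    Measurable.iSup fun b => measurable_sampleWeight (hA b)
  let e := MeasurableEquiv.arrowProdEquivProdArrow E E κ
  have he : MeasurePreserving e _ _ :=
    measurePreserving_arrowProdEquivProdArrow E E κ (fun _ => ν) (fun _ => ν)
  -- Markov's inequality with Fubini: for `y ∈ U` the witness `b` depends on `y` alone, so the ghost
  -- sample can be integrated out with `b` fixed. The exponents add up to `-3/20 + 1/5 = 1/20`.
  have key : ENNReal.ofReal (Real.exp (N * τ / 20)) * π U ≤ S := by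
    refine le_trans ?_ (lintegral_iSup_sampleWeight_le ν A hA S hS)
    rw [← (MeasurePreserving.symm e he).lintegral_comp hm,
      lintegral_prod (fun Z => ⨆ b, sampleWeight (A b) (e.symm Z))
        (hm.comp e.symm.measurable).aemeasurable, ← lintegral_indicator_const hUm]
    refine lintegral_mono fun y => ?_
    by_cases hy : y ∈ U
    · obtain ⟨b, hb⟩ := hy
      rw [Set.indicator_of_mem (show y ∈ U from ⟨b, hb⟩)]
      have h1 := le_prod_ite (A b) y _ hb.le
      have h2 := lintegral_prod_ite_ge (κ := κ) ν (hA b) hτ₀ (hτ b)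
      calc ENNReal.ofReal (Real.exp (N * τ / 20))
          = ENNReal.ofReal (Real.exp (-(3 * (N * τ / 2) / 10))) *
              ENNReal.ofReal (Real.exp (N * τ / 5)) := by
            rw [← ENNReal.ofReal_mul (Real.exp_pos _).le, ← Real.exp_add]
            ring_nf
        _ ≤ _ := mul_le_mul' h1 h2
        _ ≤ ∫⁻ z : κ → E, (∏ i, (if y i ∈ A b then ENNReal.ofReal (3 / 4) else 1)) *
              ∏ i, (if z i ∈ A b then ENNReal.ofReal (5 / 4) else 1) ∂π :=
            lintegral_const_mul_le _ _
        _ ≤ _ := lintegral_mono fun z => by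
            refine le_trans (le_of_eq ?_) (le_iSup (fun b => sampleWeight (A b) (e.symm (y, z))) b)
            rw [← Finset.prod_mul_distrib]
            refine Finset.prod_congr rfl fun i _ => ?_
            rfl
    · simp [hy]
  have hreal := ENNReal.toReal_mono (by simp) key
  rw [ENNReal.toReal_mul, ENNReal.toReal_ofReal (Real.exp_pos _).le, ENNReal.toReal_natCast]
    at hreal
  rw [Real.exp_neg, ← div_eq_mul_inv, le_div_iff₀ (Real.exp_pos _), mul_comm]
  exact hreal

end GhostSample

/-! ### VC dimension of half-spaces -/

section Traces

/-- A sum of binomial coefficients is bounded by its generating function. -/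
lemma sum_Iic_choose_le (M K : ℕ) {u : ℝ} (hu₀ : 0 < u) (hu₁ : u ≤ 1) :
    ((∑ k ∈ Finset.Iic K, M.choose k : ℕ) : ℝ) ≤ Real.exp (K * Real.log u⁻¹ + u * M) := by
  have h1 : ((∑ k ∈ Finset.Iic K, M.choose k : ℕ) : ℝ) * u ^ K ≤ (u + 1) ^ M := by
    have h : ∀ k ∈ Finset.Iic K, (M.choose k : ℝ) * u ^ K ≤
        if k ∈ Finset.range (M + 1) then u ^ k * M.choose k else 0 := by
      intro k hk
      split_ifs with hkM
      · rw [mul_comm]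
        exact mul_le_mul_of_nonneg_right
          (pow_le_pow_of_le_one hu₀.le hu₁ (Finset.mem_Iic.1 hk)) (Nat.cast_nonneg _)
      · rw [Nat.choose_eq_zero_of_lt (by simpa using hkM)]; simp
    rw [add_pow, Nat.cast_sum, Finset.sum_mul]
    refine (Finset.sum_le_sum h).trans ?_
    rw [← Finset.sum_filter]
    simp only [one_pow, mul_one]
    refine Finset.sum_le_sum_of_subset_of_nonneg ?_ fun k _ _ => by positivity
    intro k hk
    exact (Finset.mem_filter.1 hk).2
  rw [Real.exp_add, mul_comm (K : ℝ), Real.exp_mul, Real.exp_log (inv_pos.2 hu₀), mul_comm u,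
    Real.exp_nat_mul, Real.rpow_natCast, inv_pow, ← div_eq_inv_mul, le_div_iff₀ (by positivity)]
  refine h1.trans ?_
  gcongr
  exact Real.add_one_le_exp u

variable {T J : Type*} [Fintype T] [Fintype J] [DecidableEq J]

open Classical in
/-- The traces of the half-spaces `1 ≤ ⟨c, ·⟩` on a finite family of points. -/
noncomputable def halfspaceTraces (w : J → T → ℝ) : Finset (Finset J) :=
  {u | ∃ c : T → ℝ, u = Finset.univ.filter fun j => 1 ≤ ∑ t, c t * w j t}

/-- Radon's theorem: more points would split into two parts with intersecting convex hulls, and no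
half-space can cut out one part from the other. -/
lemma card_le_of_shatters_halfspaceTraces (w : J → T → ℝ) {s : Finset J}
    (hs : (halfspaceTraces w).Shatters s) : s.card ≤ Fintype.card T + 1 := by
  classical
  by_contra! hcard
  have hdep : ¬ AffineIndependent ℝ fun j : s => w j := fun h => by
    have h1 := h.card_le_finrank_succ
    have h2 := Submodule.finrank_le (vectorSpan ℝ (Set.range fun j : s => w j))
    rw [Module.finrank_fintype_fun_eq_card] at h2
    rw [Fintype.card_coe] at h1
    omega
  obtain ⟨I, z, hz, hz'⟩ := Convex.radon_partition hdep
  obtain ⟨u, hu, hsu⟩ := hs (t := s.filter fun j => ∃ h : j ∈ s, (⟨j, h⟩ : s) ∈ I)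
    (Finset.filter_subset _ _)
  simp only [halfspaceTraces, Finset.mem_filter, Finset.mem_univ, true_and] at hu
  obtain ⟨c, rfl⟩ := hu
  have hlin : IsLinearMap ℝ fun x : T → ℝ => ∑ t, c t * x t :=
    { map_add := fun x y => by simp [mul_add, Finset.sum_add_distrib]
      map_smul := fun a x => by
        simp only [Pi.smul_apply, smul_eq_mul, Finset.mul_sum]
        exact Finset.sum_congr rfl fun t _ => by ring }
  have hmem : ∀ j : s, j ∈ I ↔ 1 ≤ ∑ t, c t * w j t := fun j => by
    have := congrArg (fun v => (j : J) ∈ v) hsu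
    simpa [j.2] using this.symm
  have h1 : z ∈ {x : T → ℝ | 1 ≤ ∑ t, c t * x t} := by
    refine convexHull_min ?_ (convex_halfSpace_ge hlin 1) hz
    rintro _ ⟨j, hj, rfl⟩
    exact (hmem j).1 hj
  have h2 : z ∈ {x : T → ℝ | ∑ t, c t * x t < 1} := by
    refine convexHull_min ?_ (convex_halfSpace_lt hlin 1) hz'
    rintro _ ⟨j, hj, rfl⟩
    exact not_le.1 fun h => hj ((hmem j).2 h)
  rw [Set.mem_ofPred_eq] at h1 h2
  exact h2.not_ge h1

lemma card_halfspaceTraces_le (w : J → T → ℝ) :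
    (halfspaceTraces w).card ≤
      ∑ k ∈ Finset.Iic (Fintype.card T + 1), (Fintype.card J).choose k := by
  refine (Finset.card_le_card_shatterer _).trans (Finset.card_shatterer_le_sum_vcDim.trans ?_)
  refine Finset.sum_le_sum_of_subset (Finset.Iic_subset_Iic.2 ?_)
  exact Finset.sup_le fun s hs =>
    card_le_of_shatters_halfspaceTraces w (Finset.mem_shatterer.1 hs)

end Traces

/-! ### Counting supports and traces -/

section Supports

/-- Combines `a.choose b ≤ a^b / b!` with `b^b / b! ≤ e^b`. -/
lemma choose_le_exp (a b : ℕ) (ha : 1 ≤ a) (hb : 1 ≤ b) :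
    (a.choose b : ℝ) ≤ Real.exp (b * Real.log (Real.exp 1 * a / b)) := by
  have h1 : ((b : ℝ) ^ b) / b.factorial ≤ Real.exp b :=
    Real.pow_div_factorial_le_exp b (by positivity) b
  have ha' : (0 : ℝ) < a := by exact_mod_cast ha
  have hb' : (0 : ℝ) < b := by exact_mod_cast hb
  rw [mul_comm (b : ℝ), Real.exp_mul, Real.exp_log (by positivity), Real.rpow_natCast, div_pow,
    mul_pow, ← Real.exp_nat_mul, mul_one]
  refine (Nat.choose_le_pow_div b a).trans ?_
  rw [div_le_div_iff₀ (by positivity) (by positivity)]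
  rw [div_le_iff₀ (by positivity)] at h1
  nlinarith [pow_pos ha' b]

variable {p m : ℕ}

open Classical in
/-- The candidates for the supports of the members of the double sparse parameter space. -/
noncomputable def supportSets (G : Fin m → Finset (Fin p)) (s k : ℕ) : Finset (Finset (Fin p)) :=
  (Finset.univ.powersetCard s).biUnion fun J => (J.biUnion G).powersetCard k

lemma card_supportSets_le {d : ℕ} {G : Fin m → Finset (Fin p)} (hG : IsGrouping d G) (s k : ℕ) :
    (supportSets G s k).card ≤ m.choose s * (s * d).choose k := by
  classical
  refine (Finset.card_biUnion_le_card_mul _ _ ((s * d).choose k) fun J hJ => ?_).trans ?_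
  · rw [Finset.card_powersetCard]
    refine Nat.choose_le_choose k (Finset.card_biUnion_le.trans ?_)
    rw [Finset.sum_congr rfl fun j _ => hG.card_eq j, Finset.sum_const, smul_eq_mul,
      (Finset.mem_powersetCard.1 hJ).2]
  · rw [Finset.card_powersetCard, Finset.card_univ, Fintype.card_fin]

lemma card_of_mem_supportSets {G : Fin m → Finset (Fin p)} {s k : ℕ} {T : Finset (Fin p)}
    (hT : T ∈ supportSets G s k) : T.card = k := by
  classical
  obtain ⟨J, -, hJ⟩ := Finset.mem_biUnion.1 hT
  exact (Finset.mem_powersetCard.1 hJ).2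

/-- The active groups are padded to exactly `s`, then the support to exactly `s * s₀` inside their
union, which has room because `s₀ ≤ d`. -/
lemma exists_mem_supportSets {d : ℕ} {G : Fin m → Finset (Fin p)} (hG : IsGrouping d G)
    {s s₀ : ℕ} (hs : s ≤ m) (hs₀ : s₀ ≤ d) {β : EuclideanSpace ℝ (Fin p)}
    (hβ : β ∈ doubleSparse G s s₀) :
    ∃ T ∈ supportSets G s (s * s₀), ∀ i, β i ≠ 0 → i ∈ T := by
  classical
  obtain ⟨h1, h2⟩ := hβ
  rw [groupZeroNorm, Set.ncard_eq_toFinset_card'] at h1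
  rw [zeroNorm, Set.ncard_eq_toFinset_card'] at h2
  obtain ⟨J, hJ, hJc⟩ := Finset.exists_superset_card_eq h1 (by simpa using hs)
  have hsub : {i : Fin p | β i ≠ 0}.toFinset ⊆ J.biUnion G := fun i hi => by
    rw [Set.mem_toFinset] at hi
    obtain ⟨j, hj⟩ := hG.cover i
    exact Finset.mem_biUnion.2 ⟨j, hJ (Set.mem_toFinset.2 ⟨i, hj, hi⟩), hj⟩
  have hcard : (J.biUnion G).card = s * d := by
    rw [Finset.card_biUnion fun j _ k _ hjk => hG.disjoint j k hjk,
      Finset.sum_congr rfl fun j _ => hG.card_eq j, Finset.sum_const, smul_eq_mul, hJc]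
  obtain ⟨T, hT, hTJ, hTc⟩ := Finset.exists_subsuperset_card_eq hsub h2
    (hcard ▸ Nat.mul_le_mul_left s hs₀)
  refine ⟨T, ?_, fun i hi => hT (Set.mem_toFinset.2 hi)⟩
  exact Finset.mem_biUnion.2 ⟨J, Finset.mem_powersetCard.2 ⟨Finset.subset_univ _, hJc⟩,
    Finset.mem_powersetCard.2 ⟨hTJ, hTc⟩⟩

/-- The set of the vectors whose inner product with `β` is at least `θ ‖β‖` in absolute value. -/
def slabCompl (θ : ℝ) (β : EuclideanSpace ℝ (Fin p)) : Set (EuclideanSpace ℝ (Fin p)) :=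
  {v | θ * ‖β‖ ≤ |inner ℝ β v|}

/-- The number of traces which the sets `slabCompl θ β`, for `β` in the double sparse parameter
space, leave on finitely many points. -/
theorem exists_traces_slabCompl {d : ℕ} {G : Fin m → Finset (Fin p)} (hG : IsGrouping d G)
    {s s₀ : ℕ} (hs : s ≤ m) (hs₀ : s₀ ≤ d) {θ : ℝ} (hθ : 0 < θ)
    {J : Type*} [Fintype J] [DecidableEq J] (v : J → EuclideanSpace ℝ (Fin p)) :
    ∃ F : Finset (Finset J),
      F.card ≤ m.choose s * (s * d).choose (s * s₀) *
        ∑ k ∈ Finset.Iic (s * s₀ + 1), (2 * Fintype.card J).choose k ∧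
      ∀ β ∈ doubleSparse G s s₀, β ≠ 0 → sampleTrace v (slabCompl θ β) ∈ F := by
  classical
  -- The absolute value makes the set a union of two opposite half-spaces. Adjoining the points `-v
  -- j` encodes its trace by that of a single half-space.
  let w (T : Finset (Fin p)) : J ⊕ J → T → ℝ := Sum.elim (fun j t => v j t) fun j t => -v j t
  refine ⟨(supportSets G s (s * s₀)).biUnion fun T => (halfspaceTraces (w T)).image fun u =>
    Finset.univ.filter fun j => Sum.inl j ∈ u ∨ Sum.inr j ∈ u, ?_, fun β hβ hβ0 => ?_⟩
  · refine (Finset.card_biUnion_le_card_mul _ _ _ fun T hT => ?_).trans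
      (Nat.mul_le_mul_right _ (card_supportSets_le hG s (s * s₀)))
    refine Finset.card_image_le.trans ((card_halfspaceTraces_le _).trans (le_of_eq ?_))
    rw [Fintype.card_coe, card_of_mem_supportSets hT, Fintype.card_sum, two_mul]
  · obtain ⟨T, hT, hβT⟩ := exists_mem_supportSets hG hs hs₀ hβ
    refine Finset.mem_biUnion.2 ⟨T, hT, Finset.mem_image.2 ⟨Finset.univ.filter fun j =>
      1 ≤ ∑ t : T, (β t / (θ * ‖β‖)) * w T j t, ?_, ?_⟩⟩
    · simp only [halfspaceTraces, Finset.mem_filter, Finset.mem_univ, true_and]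
      exact ⟨fun t => β t / (θ * ‖β‖), rfl⟩
    · have hpos : 0 < θ * ‖β‖ := mul_pos hθ (norm_pos_iff.2 hβ0)
      have hin : ∀ j, ∑ t : T, (β t / (θ * ‖β‖)) * v j t = inner ℝ β (v j) / (θ * ‖β‖) := by
        intro j
        rw [PiLp.inner_apply, Finset.sum_div, Finset.sum_coe_sort T
          (fun t => (β t / (θ * ‖β‖)) * v j t)]
        rw [Finset.sum_subset (Finset.subset_univ T)]
        · refine Finset.sum_congr rfl fun i _ => ?_
          simp only [RCLike.inner_apply, conj_trivial]
          ring
        · intro i _ hi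
          rw [not_not.1 fun h => hi (hβT i h)]; simp
      ext j
      simp only [w, Finset.mem_filter, Finset.mem_univ, true_and, Sum.elim_inl, Sum.elim_inr,
        mem_sampleTrace, slabCompl, Set.mem_ofPred_eq, mul_neg, Finset.sum_neg_distrib, hin,
        le_abs, one_le_div hpos, ← neg_div]

end Supports

/-! ### Topology of the parameter space and the passage from counts to norms -/

section DoubleSparse

variable {n p m : ℕ} {G : Fin m → Finset (Fin p)} {s s₀ : ℕ}

lemma mem_doubleSparse_of_support_subset {β γ : EuclideanSpace ℝ (Fin p)}
    (hβ : β ∈ doubleSparse G s s₀) (h : ∀ i, γ i ≠ 0 → β i ≠ 0) : γ ∈ doubleSparse G s s₀ := by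
  refine ⟨le_trans (Set.ncard_le_ncard ?_ (Set.toFinite _)) hβ.1,
    le_trans (Set.ncard_le_ncard h (Set.toFinite _)) hβ.2⟩
  rintro j ⟨i, hi, hγ⟩
  exact ⟨i, hi, h i hγ⟩

/-- Nonzero coordinates stay nonzero nearby, so supports cannot shrink under small perturbations and
the complement is open. -/
lemma isClosed_doubleSparse : IsClosed (doubleSparse G s s₀) := by
  rw [← isOpen_compl_iff, isOpen_iff_mem_nhds]
  intro β hβ
  have h : ∀ᶠ γ in nhds β, ∀ i, β i ≠ 0 → γ i ≠ 0 := by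
    refine Filter.eventually_all.2 fun i => ?_
    by_cases hi : β i = 0
    · simp [hi]
    · have hc : Continuous fun γ : EuclideanSpace ℝ (Fin p) => γ i := by fun_prop
      exact (hc.continuousAt.eventually_ne hi).mono fun γ hγ _ => hγ
  filter_upwards [h] with γ hγ hγ'
  exact hβ (mem_doubleSparse_of_support_subset hγ' hγ)

lemma exists_ne_zero_mem_doubleSparse {d : ℕ} (hG : IsGrouping d G) (hs : 1 ≤ s) (hsm : s ≤ m)
    (hs₀ : 1 ≤ s₀) (hs₀d : s₀ ≤ d) : ∃ β ∈ doubleSparse G s s₀, β ≠ 0 := by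
  obtain ⟨i, hi⟩ : (G ⟨0, by omega⟩).Nonempty := by
    rw [← Finset.card_pos, hG.card_eq]; omega
  refine ⟨EuclideanSpace.single i 1, ⟨?_, ?_⟩, by simp⟩
  · refine le_trans ?_ hs
    refine (Set.ncard_le_one_iff (Set.toFinite _)).2 ?_
    rintro j k ⟨a, ha, ha'⟩ ⟨b, hb, hb'⟩
    have ha'' : a = i := by by_contra h; simp [h] at ha'
    have hb'' : b = i := by by_contra h; simp [h] at hb'
    subst ha'' hb''
    by_contra hjk
    exact Finset.disjoint_left.1 (hG.disjoint j k hjk) ha hb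
  · refine le_trans ?_ (Nat.mul_le_mul hs hs₀)
    refine (Set.ncard_le_one_iff (Set.toFinite _)).2 ?_
    intro a b ha hb
    have ha'' : a = i := by by_contra h; simp [h] at ha
    have hb'' : b = i := by by_contra h; simp [h] at hb
    rw [ha'', hb'']

lemma imageNorm_smul (X : Matrix (Fin n) (Fin p) ℝ) (c : ℝ) (β : EuclideanSpace ℝ (Fin p)) :
    imageNorm X (c • β) = |c| * imageNorm X β := by
  simp [imageNorm, Matrix.mulVec_smul, norm_smul]

lemma imageNorm_smul_matrix (X : Matrix (Fin n) (Fin p) ℝ) (c : ℝ)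
    (β : EuclideanSpace ℝ (Fin p)) : imageNorm (c • X) β = |c| * imageNorm X β := by
  simp [imageNorm, Matrix.smul_mulVec, norm_smul]

lemma continuous_imageNorm (X : Matrix (Fin n) (Fin p) ℝ) : Continuous (imageNorm X) := by
  unfold imageNorm
  fun_prop

/-- A uniform lower bound for `‖Xβ‖ / ‖β‖` on the double sparse parameter space implies the double
sparse restricted eigenvalue condition, since the minimum is attained. -/
lemma exists_DSRE_of_le (hne : ∃ β ∈ doubleSparse G s s₀, β ≠ 0) (X : Matrix (Fin n) (Fin p) ℝ)
    {c : ℝ} (hc : 0 < c) (h : ∀ β ∈ doubleSparse G s s₀, c * ‖β‖ ≤ imageNorm X β) :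
    ∃ θ, c ≤ θ ∧ DSRE G s s₀ θ X := by
  have hnormalize : ∀ β ∈ doubleSparse G s s₀, β ≠ 0 →
      ‖β‖⁻¹ • β ∈ doubleSparse G s s₀ ∩ Metric.sphere 0 1 := fun β hβ h0 =>
    ⟨mem_doubleSparse_of_support_subset hβ fun i hi h => hi (by simp [h]),
      by simp [norm_smul, h0]⟩
  have hK : IsCompact (doubleSparse G s s₀ ∩ Metric.sphere 0 1) :=
    (isCompact_sphere _ _).inter_left isClosed_doubleSparse
  obtain ⟨β₁, hβ₁, h₁⟩ := hne
  obtain ⟨β₀, ⟨hβ₀, hn⟩, hmin⟩ := hK.exists_isMinOn ⟨_, hnormalize β₁ hβ₁ h₁⟩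
    (continuous_imageNorm X).continuousOn
  rw [mem_sphere_zero_iff_norm] at hn
  have hc₀ : c ≤ imageNorm X β₀ := by simpa [hn] using h β₀ hβ₀
  refine ⟨imageNorm X β₀, hc₀, hc.trans_le hc₀, ⟨β₀, hβ₀, ?_, by simp [hn]⟩, ?_⟩
  · rintro rfl; simp at hn
  · rintro _ ⟨β, hβ, h0, rfl⟩
    have := isMinOn_iff.1 hmin _ (hnormalize β hβ h0)
    rwa [imageNorm_smul, abs_of_nonneg (by positivity), ← div_eq_inv_mul] at this

lemma isClosed_slabCompl (θ : ℝ) (β : EuclideanSpace ℝ (Fin p)) : IsClosed (slabCompl θ β) :=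
  isClosed_le continuous_const (by fun_prop)

/-- Every direction may be replaced by one from a dense set which is hit by fewer points. -/
lemma exists_sampleTrace_subset {J : Type*} [Fintype J] {θ : ℝ}
    {P : Set (EuclideanSpace ℝ (Fin p))} {D : Set P} (hD : Dense D)
    (v : J → EuclideanSpace ℝ (Fin p)) {β : EuclideanSpace ℝ (Fin p)} (hβ : β ∈ P) :
    ∃ b ∈ D, sampleTrace v (slabCompl θ b) ⊆ sampleTrace v (slabCompl θ β) := by
  -- A miss is a strict inequality, hence an open condition on `β`; there are only finitely many
  -- points.
  have h : ∀ᶠ γ : P in nhds ⟨β, hβ⟩, ∀ j, v j ∉ slabCompl θ β → v j ∉ slabCompl θ γ := by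
    refine Filter.eventually_all.2 fun j => ?_
    by_cases hj : v j ∈ slabCompl θ β
    · simp [hj]
    · have hlt : |inner ℝ β (v j)| < θ * ‖β‖ := not_le.1 hj
      have hc₁ : Continuous fun γ : P => |inner ℝ (γ : EuclideanSpace ℝ (Fin p)) (v j)| := by
        fun_prop
      have hc₂ : Continuous fun γ : P => θ * ‖(γ : EuclideanSpace ℝ (Fin p))‖ := by fun_prop
      exact (hc₁.continuousAt.eventually_lt hc₂.continuousAt hlt).mono fun γ hγ _ =>
        not_le.2 hγ
  obtain ⟨b, hb, hbD⟩ := hD.exists_mem_open isOpen_interior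
    ⟨_, mem_interior_iff_mem_nhds.2 h⟩
  refine ⟨b, hb, fun j hj => ?_⟩
  rw [mem_sampleTrace] at hj ⊢
  exact not_not.1 fun hj' => interior_subset hbD j hj' hj

/-- Each hit contributes at least `(θ‖β‖)²` to `‖Xβ‖²`. -/
lemma mul_norm_le_imageNorm {θ c : ℝ} (hθ : 0 ≤ θ) (v : Fin n → EuclideanSpace ℝ (Fin p))
    (β : EuclideanSpace ℝ (Fin p)) (h : c ≤ (sampleTrace v (slabCompl θ β)).card) :
    √c * θ * ‖β‖ ≤ imageNorm (matrixOfRows v) β := by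
  have h1 : imageNorm (matrixOfRows v) β ^ 2 = ∑ j, inner ℝ β (v j) ^ 2 := by
    rw [imageNorm, EuclideanSpace.norm_sq_eq]
    refine Finset.sum_congr rfl fun j _ => ?_
    simp [matrixOfRows, Matrix.mulVec, dotProduct, PiLp.inner_apply, sq_abs]
  have h2 : (sampleTrace v (slabCompl θ β)).card * (θ * ‖β‖) ^ 2 ≤ ∑ j, inner ℝ β (v j) ^ 2 := by
    rw [← nsmul_eq_mul]
    refine (Finset.card_nsmul_le_sum _ (fun j => inner ℝ β (v j) ^ 2) _ fun j hj => ?_).trans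
      (Finset.sum_le_univ_sum_of_nonneg fun j => sq_nonneg _)
    rw [mem_sampleTrace] at hj
    rw [← sq_abs (inner ℝ β (v j))]
    exact pow_le_pow_left₀ (by positivity) hj 2
  rcases le_or_gt c 0 with hc | hc
  · rw [Real.sqrt_eq_zero_of_nonpos hc]; simp [imageNorm]
  · refine abs_le_of_sq_le_sq' ?_ (norm_nonneg _) |>.2
    change _ ≤ imageNorm (matrixOfRows v) β ^ 2
    rw [h1, mul_assoc, mul_pow, Real.sq_sqrt hc.le]
    exact le_trans (by gcongr) h2

end DoubleSparse

/-! ### Numerical constants and conclusion -/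

lemma card_bound_mul_exp_lt {m d s s₀ n : ℕ} (hs : 1 ≤ s) (hsm : s ≤ m) (hs₀ : 1 ≤ s₀)
    (hs₀d : s₀ ≤ d) {τ : ℝ} (hτ₀ : 0 < τ) (hτ₁ : τ ≤ 1)
    (hn : 1500 / τ ^ 2 * ((s : ℝ) * Real.log (Real.exp 1 * m / s)
      + (s : ℝ) * s₀ * Real.log (Real.exp 1 * d / s₀)) ≤ n) :
    1 ≤ n * τ ∧
    ((m.choose s * (s * d).choose (s * s₀) *
        ∑ k ∈ Finset.Iic (s * s₀ + 1), (2 * (n * 2)).choose k : ℕ) : ℝ) *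
      Real.exp (-(n * τ / 20)) < Real.exp (-(1 / 100 * n * τ ^ 2)) := by
  set L := (s : ℝ) * Real.log (Real.exp 1 * m / s)
      + (s : ℝ) * s₀ * Real.log (Real.exp 1 * d / s₀) with hL
  have hsR : (1 : ℝ) ≤ s := by exact_mod_cast hs
  have hs₀R : (1 : ℝ) ≤ s₀ := by exact_mod_cast hs₀
  have hlog : ∀ a b : ℕ, 1 ≤ b → b ≤ a → 1 ≤ Real.log (Real.exp 1 * a / b) := by
    intro a b hb hba
    have hb' : (0 : ℝ) < b := by exact_mod_cast hb
    have hba' : (b : ℝ) ≤ a := by exact_mod_cast hba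
    rw [Real.le_log_iff_exp_le (by have := hb'.trans_le hba'; positivity), le_div_iff₀ hb']
    gcongr
  have hL₁ : (s : ℝ) + s * s₀ ≤ L := by
    have h1 := hlog m s hs hsm
    have h2 := hlog d s₀ hs₀ hs₀d
    have : (0 : ℝ) ≤ s * s₀ := by positivity
    rw [hL]; nlinarith
  have hLn : 1500 * L ≤ n * τ ^ 2 := by
    rw [div_mul_eq_mul_div, div_le_iff₀ (by positivity)] at hn
    exact hn
  have hss : (1 : ℝ) ≤ s * s₀ := by nlinarith
  have hnτ : 1500 * L / τ ≤ n * τ := by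
    rw [div_le_iff₀ hτ₀]; nlinarith
  have hLτ : L ≤ L / τ := by
    rw [le_div_iff₀ hτ₀]; nlinarith
  have hLτ' : L / τ * 1500 ≤ n * τ := by linarith [mul_div_assoc 1500 L τ]
  have hnτ₁ : 1 ≤ n * τ := by linarith
  refine ⟨hnτ₁, ?_⟩
  have hc₁ := choose_le_exp m s (hs.trans hsm) hs
  have hc₂ := choose_le_exp (s * d) (s * s₀) (Nat.mul_pos hs (hs₀.trans hs₀d)) (Nat.mul_pos hs hs₀)
  -- There are `4n` points: sample and ghost, each with both signs. With `u = τ/400` they cost only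
  -- `nτ/100` in the exponent.
  have hc₃ := sum_Iic_choose_le (2 * (n * 2)) (s * s₀ + 1) (u := τ / 400) (by positivity)
    (by linarith)
  have hq : Real.exp 1 * ((s * d : ℕ) : ℝ) / ((s * s₀ : ℕ) : ℝ) = Real.exp 1 * d / s₀ := by
    push_cast
    field_simp
  rw [hq] at hc₂
  have hlog400 : Real.log (τ / 400)⁻¹ ≤ 7 / τ := by
    rw [inv_div, Real.log_div (by norm_num) hτ₀.ne']
    have h1 : Real.log 400 ≤ 7 := by
      rw [Real.log_le_iff_le_exp (by norm_num)]
      have h2 : Real.exp 7 = Real.exp 1 ^ 7 := by rw [← Real.exp_nat_mul]; norm_num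
      have h3 : (2.7 : ℝ) ≤ Real.exp 1 := by linarith [Real.exp_one_gt_d9]
      rw [h2]
      refine le_trans (by norm_num) (pow_le_pow_left₀ (by norm_num) h3 7)
    have h2 := Real.one_sub_inv_le_log_of_pos hτ₀
    rw [le_div_iff₀ hτ₀]
    have h3 : (1 - τ⁻¹) * τ ≤ Real.log τ * τ := by gcongr
    rw [sub_mul, inv_mul_cancel₀ hτ₀.ne'] at h3
    nlinarith
  have hexp : ((s * s₀ + 1 : ℕ) : ℝ) * Real.log (τ / 400)⁻¹ ≤ 14 * (L / τ) := by
    calc ((s * s₀ + 1 : ℕ) : ℝ) * Real.log (τ / 400)⁻¹ ≤ (2 * L) * (7 / τ) := by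
          refine mul_le_mul (by push_cast; linarith) hlog400 ?_ (by linarith)
          exact Real.log_nonneg (by rw [one_le_inv₀ (by positivity)]; linarith)
      _ = _ := by ring
  rw [Nat.cast_mul, Nat.cast_mul]
  calc _ ≤ Real.exp (s * Real.log (Real.exp 1 * m / s)) *
          Real.exp ((s * s₀ : ℕ) * Real.log (Real.exp 1 * d / s₀)) *
          Real.exp ((s * s₀ + 1 : ℕ) * Real.log (τ / 400)⁻¹ + τ / 400 * (2 * (n * 2) : ℕ)) *
          Real.exp (-(n * τ / 20)) := by gcongr
    _ < _ := by
      rw [← Real.exp_add, ← Real.exp_add, ← Real.exp_add, Real.exp_lt_exp]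
      have h1 : (n : ℝ) * τ ^ 2 ≤ n * τ := by nlinarith
      push_cast at hexp ⊢
      -- `L + 14 L/τ ≤ 15 L/τ ≤ nτ/100`, so the exponent is at most `nτ (1/100 + 1/100 - 1/20) =
      -- -3nτ/100 < -nτ²/100`.
      linarith

theorem mainTheorem9 :
    ∃ C C' : ℝ, 0 < C ∧ 0 < C' ∧
      ∀ (p m d n s s₀ : ℕ) (G : Fin m → Finset (Fin p)), IsGrouping d G →
        1 ≤ s → s ≤ m → 1 ≤ s₀ → s₀ ≤ d →
      ∀ (Ω₀ : Type*) [MeasurableSpace Ω₀] (μ₀ : Measure Ω₀) [IsProbabilityMeasure μ₀]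
        (x : Ω₀ → EuclideanSpace ℝ (Fin p)) (τ θmin : ℝ), 0 < τ → 0 < θmin →
        SmallBall μ₀ x G s s₀ τ θmin →
      ∀ (Ω : Type*) [MeasurableSpace Ω] (μ : Measure Ω) [IsProbabilityMeasure μ]
        (row : Fin n → Ω → EuclideanSpace ℝ (Fin p)),
        iIndepFun row μ → (∀ i, IdentDistrib (row i) x μ μ₀) →
        C / τ ^ 2 * ((s : ℝ) * Real.log (Real.exp 1 * m / s)
          + (s : ℝ) * s₀ * Real.log (Real.exp 1 * d / s₀)) ≤ (n : ℝ) →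
        1 - Real.exp (-(C' * n * τ ^ 2)) <
          μ.real {ω |
            (∃ θ : ℝ, θmin / √2 ≤ θ ∧
              DSRE G s s₀ θ (matrixOfRows fun i => row i ω)) ∧
            (∃ θ' : ℝ, √(τ / 2) * θmin ≤ θ' ∧
              DSRE G s s₀ θ' ((√(n : ℝ))⁻¹ • matrixOfRows fun i => row i ω))} := by
  refine ⟨1500, 1 / 100, by norm_num, by norm_num, ?_⟩
  intro p m d n s s₀ G hG hs hsm hs₀ hs₀d Ω₀ _ μ₀ _ x τ θmin hτ₀ hθ hsb Ω _ μ _ row hind hid hn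
  obtain ⟨β₁, hβ₁, hβ₁0⟩ := exists_ne_zero_mem_doubleSparse hG hs hsm hs₀ hs₀d
  have hτ₁ : τ ≤ 1 := (hsb β₁ hβ₁).trans measureReal_le_one
  obtain ⟨hnτ, hbound⟩ := card_bound_mul_exp_lt hs hsm hs₀ hs₀d hτ₀ hτ₁ hn
  have hn₀ : 0 < n := Nat.pos_of_ne_zero fun h => by subst h; norm_num at hnτ
  have hx : AEMeasurable x μ₀ := (hid ⟨0, hn₀⟩).aemeasurable_snd
  set ν : Measure (EuclideanSpace ℝ (Fin p)) := μ₀.map x with hν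
  have : IsProbabilityMeasure ν := Measure.isProbabilityMeasure_map hx
  have hlaw : μ.map (fun ω i => row i ω) = Measure.pi fun _ => ν := by
    rw [(iIndepFun_iff_map_fun_eq_pi_map fun i => (hid i).aemeasurable_fst).1 hind]
    congr 1
    exact funext fun i => (hid i).map_eq
  set P : Set (EuclideanSpace ℝ (Fin p)) := {β | β ∈ doubleSparse G s s₀ ∧ β ≠ 0}
  -- The deviation inequality is for countable families; `exists_sampleTrace_subset` carries its
  -- conclusion from `D` to all of `P`.
  obtain ⟨D, hDc, hD⟩ := TopologicalSpace.exists_countable_dense P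
  have := hDc.to_subtype
  have hdev := measureReal_exists_card_sampleTrace_lt_le (κ := Fin n) ν
    (fun b : D => slabCompl θmin (b : P)) (fun b => (isClosed_slabCompl _ _).measurableSet) hτ₀
    (fun b => by
      rw [measureReal_def, Measure.map_apply_of_aemeasurable hx
        (isClosed_slabCompl _ _).measurableSet]
      exact hsb _ b.1.2.1)
    (m.choose s * (s * d).choose (s * s₀) *
      ∑ k ∈ Finset.Iic (s * s₀ + 1), (2 * (n * 2)).choose k)
    (fun v => by
      obtain ⟨F, hF, hF'⟩ := exists_traces_slabCompl hG hsm hs₀d hθ v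
      refine ⟨F, by simpa using hF, fun b => hF' _ b.1.2.1 b.1.2.2⟩)
  rw [Fintype.card_fin] at hdev
  have hlt := hdev.trans_lt hbound
  set U : Set (Fin n → EuclideanSpace ℝ (Fin p)) :=
    {y | ∃ b : D, ((sampleTrace y (slabCompl θmin (b : P))).card : ℝ) < n * τ / 2}
  set W : Set Ω := {ω | (∃ θ : ℝ, θmin / √2 ≤ θ ∧
    DSRE G s s₀ θ (matrixOfRows fun i => row i ω)) ∧ (∃ θ' : ℝ, √(τ / 2) * θmin ≤ θ' ∧
    DSRE G s s₀ θ' ((√(n : ℝ))⁻¹ • matrixOfRows fun i => row i ω))}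
  have hgood : ∀ ω, (fun i => row i ω) ∉ U → ω ∈ W := by
    intro ω hω
    have hcount : ∀ β ∈ doubleSparse G s s₀,
        √(n * τ / 2) * θmin * ‖β‖ ≤ imageNorm (matrixOfRows fun i => row i ω) β := by
      intro β hβ
      by_cases h0 : β = 0
      · simp [h0, imageNorm]
      refine mul_norm_le_imageNorm hθ.le _ β ?_
      obtain ⟨b, hb, hsub⟩ := exists_sampleTrace_subset (θ := θmin) hD (fun i => row i ω)
        (show β ∈ P from ⟨hβ, h0⟩)
      refine le_trans (not_lt.1 fun h => hω ⟨⟨b, hb⟩, h⟩) ?_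
      exact_mod_cast Finset.card_le_card hsub
    have hnR : (0 : ℝ) < n := by exact_mod_cast hn₀
    refine ⟨exists_DSRE_of_le ⟨β₁, hβ₁, hβ₁0⟩ _ (by positivity) fun β hβ =>
      le_trans ?_ (hcount β hβ), exists_DSRE_of_le ⟨β₁, hβ₁, hβ₁0⟩ _ (by positivity)
      fun β hβ => ?_⟩
    · refine mul_le_mul_of_nonneg_right ?_ (norm_nonneg _)
      -- What remains is `1/2 ≤ nτ/2`, which is `hnτ`.
      rw [div_eq_inv_mul, ← Real.sqrt_inv]
      gcongr
      linarith
    · rw [imageNorm_smul_matrix, abs_of_nonneg (by positivity), ← div_eq_inv_mul,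
        le_div_iff₀ (by positivity)]
      refine le_trans (le_of_eq ?_) (hcount β hβ)
      rw [mul_div_assoc, Real.sqrt_mul hnR.le]
      ring
  have hbad : μ.real Wᶜ ≤ (Measure.pi fun _ : Fin n => ν).real U := by
    refine ENNReal.toReal_mono (measure_ne_top _ _) ?_
    rw [← hlaw]
    refine le_trans (measure_mono fun ω hω => ?_) (Measure.le_map_apply
      (aemeasurable_pi_lambda _ fun i => (hid i).aemeasurable_fst) U)
    exact not_not.1 fun h => hω (hgood ω h)
  -- Subadditivity suffices, so measurability of `W` is not needed.
  have hone : 1 ≤ μ.real W + μ.real Wᶜ := by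
    have := measureReal_union_le (μ := μ) W Wᶜ
    rwa [Set.union_compl_self, probReal_univ] at this
  linarith
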